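/- Let $d\ge 3$, $h>0$ and $R>0$. Let $\mathcal{C}_R\subset\mathbb{R}^d$ be the open right circular cylinder of radius $R$ around the line $x_1=x_2=\cdots=x_d$, i.e. the set of points whose Euclidean distance to this line is less than $R$. Put $\overline{h}=(h,\ldots,h)\in\mathbb{R}^d$ and $$V(x)=\sum_{k\in\mathbb{Z}}\frac{1}{|x-k\overline{h}|^2}.$$ Let $C_0^\infty(\mathcal{C}_R)$ denote the real-valued smooth functions with compact support contained in $\mathcal{C}_R$. Then: (i) There is a finite constant $C=C(h,R)\in\mathbb{R}$ (for the fixed dimension $d$) such that, for every $u\in C_0^\infty(\mathcal{C}_R)$, the function $Vu^2$ is integrable on $\mathcal{C}_R$ and $$C\int_{\mathcal{C}_R}u^2\,dx+\int_{\mathcal{C}_R}|\nabla u|^2\,dx\ \ge\ \frac{(d-2)^2}{4}\int_{\mathcal{C}_R}Vu^2\,dx.$$ (ii) For every $\mu>\frac{(d-2)^2}{4}$ and every $\lambda\in\mathbb{R}$ there is $u_{\lambda,\mu}\in C_0^\infty(\mathcal{C}_R)$ (with $Vu_{\lambda,\mu}^2$ integrable on $\mathcal{C}_R$) such that $$\lambda\int_{\mathcal{C}_R}u_{\lambda,\mu}^2\,dx+\int_{\mathcal{C}_R}|\nabla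 u_{\lambda,\mu}|^2\,dx\ <\ \mu\int_{\mathcal{C}_R}Vu_{\lambda,\mu}^2\,dx.$$ -/

import Mathlib

open MeasureTheory
open scoped ContDiff

noncomputable section

namespace HardyCylinder

/-- The vector `(h, …, h)` of `ℝ^d`. -/
def hbar (d : ℕ) (h : ℝ) : EuclideanSpace ℝ (Fin d) := WithLp.toLp 2 (fun _ => h)

/-- The inverse square potential `V(x) = ∑_{k ∈ ℤ} 1 / |x - k (h, …, h)|²`. For `h ≠ 0` and `d ≥ 1`
the series converges at every point; at a pole the pole's own term is `0` by convention. -/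
def potential (d : ℕ) (h : ℝ) (x : EuclideanSpace ℝ (Fin d)) : ℝ :=
  ∑' k : ℤ, 1 / ‖x - (k : ℝ) • hbar d h‖ ^ 2

/-- The line `x₁ = x₂ = ⋯ = x_d`. -/
def axis (d : ℕ) : Set (EuclideanSpace ℝ (Fin d)) := {x | ∀ i j, x i = x j}

/-- The open right circular cylinder of radius `R` around the line `x₁ = ⋯ = x_d`. -/
def cylinder (d : ℕ) (R : ℝ) : Set (EuclideanSpace ℝ (Fin d)) :=
  {x | Metric.infDist x (axis d) < R}

/-- `u ∈ C_0^∞(Ω)`: `u` is smooth, with compact support contained in `Ω`. -/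
structure IsTestFunction {d : ℕ} (Ω : Set (EuclideanSpace ℝ (Fin d)))
    (u : EuclideanSpace ℝ (Fin d) → ℝ) : Prop where
  smooth : ContDiff ℝ ∞ u
  compact : HasCompactSupport u
  support : tsupport u ⊆ Ω

end HardyCylinder

end

/-!
The inequality is local. For a vector field `F`, expanding `∫ |∇u + F u|² ≥ 0` and integrating the
cross term by parts gives `∫ (div F - |F|²) u² ≤ ∫ |∇u|²`. Write `c = (d - 2) / 2`. With the ground
state field `F = c (x - p) / |x - p|²` the left weight is exactly `c² / |x - p|²`; cutting `F` off at
radius `ρ` costs a bounded term only. To have a `C¹` field, `F` is regularized as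
`ψ (x - p)` with `ψ = c (1 - s / ρ²)₊² / (s + ε)`, `s = |x - p|²`: the weight is then at least
`c² s / (s + ε)²` up to a constant that does not depend on `ε` (`hardyWeight_riccati`), and Fatou's
lemma as `ε → 0` gives both integrability and the inequality in a ball (`lintegral_hardy_ball_le`).
The balls of radius `h / 2` around the poles are disjoint, and in each of them `V` differs from the
term of its own pole by a bounded function, since a single coordinate separates a point from the
other poles; outside the balls `V` is bounded. Summing over the balls proves the inequality on the
whole space (`integral_potential_le`).

The constant is sharp already for the pole at the origin. In logarithmic polar coordinates
`t = log |x|` the function `u = |x|^(-c) θ(log |x|)` has, up to the same factor,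
`∫ u² / |x|² = ∫ θ²` and `∫ |∇u|² = ∫ (θ' - c θ)² = ∫ θ'² + c² ∫ θ²`. Stretching `θ` makes `∫ θ'²`
negligible, and translating it towards `-∞` supports `u` in a ball so small that `∫ u²` is negligible
too (`exists_almost_optimal`).
-/

open Set Filter Topology

namespace HardyCylinder

/-! ### The Hardy inequality in a ball -/

theorem hasCompactSupport_sq {X : Type*} [TopologicalSpace X] {u : X → ℝ}
    (hc : HasCompactSupport u) : HasCompactSupport fun x => u x ^ 2 :=
  hc.comp_left (g := fun t : ℝ => t ^ 2) (by simp)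

theorem hasCompactSupport_norm_fderiv_sq {E : Type*} [NormedAddCommGroup E] [NormedSpace ℝ E]
    {u : E → ℝ} (hc : HasCompactSupport u) : HasCompactSupport fun x => ‖fderiv ℝ u x‖ ^ 2 :=
  (hc.fderiv ℝ).comp_left (g := fun L : E →L[ℝ] ℝ => ‖L‖ ^ 2) (by simp)

/-- The divergence theorem for the compactly supported field `x ↦ g x • (x - p)`, whose divergence
is `Dg(x)(x - p) + d g(x)`. -/
theorem integral_fderiv_apply_sub_add {d : ℕ} {g : EuclideanSpace ℝ (Fin d) → ℝ}
    (hg : ContDiff ℝ 1 g) (hc : HasCompactSupport g) (p : EuclideanSpace ℝ (Fin d)) :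
    ∫ x, (fderiv ℝ g x (x - p) + d * g x) = 0 := by
  have hcont : Continuous (fderiv ℝ g) := hg.continuous_fderiv (by simp)
  have hc' : HasCompactSupport (fderiv ℝ g) := hc.fderiv ℝ
  let e : Fin d → EuclideanSpace ℝ (Fin d) := fun i => EuclideanSpace.single i (1 : ℝ)
  have hI1 : ∀ i, Integrable (fun x => (x i - p i) * fderiv ℝ g x (e i)) := fun i => by
    refine Continuous.integrable_of_hasCompactSupport (by fun_prop) ?_
    exact ((hc'.comp_left (g := fun L : EuclideanSpace ℝ (Fin d) →L[ℝ] ℝ => L (e i))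
      (by simp)).mul_left)
  have hIg : Integrable g := hg.continuous.integrable_of_hasCompactSupport hc
  have hfd : ∀ i x, fderiv ℝ (fun x : EuclideanSpace ℝ (Fin d) => x i - p i) x (e i) = 1 := by
    intro i x
    have h1 : HasFDerivAt (fun x : EuclideanSpace ℝ (Fin d) => x i - p i)
        (EuclideanSpace.proj i : EuclideanSpace ℝ (Fin d) →L[ℝ] ℝ) x :=
      ((EuclideanSpace.proj i : EuclideanSpace ℝ (Fin d) →L[ℝ] ℝ).hasFDerivAt).sub_const (p i)
    rw [h1.fderiv]
    simp [e]
  have key : ∀ i, ∫ x, ((x i - p i) * fderiv ℝ g x (e i) + g x) = 0 := fun i => by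
    rw [integral_add (hI1 i) hIg, integral_mul_fderiv_eq_neg_fderiv_mul_of_integrable]
    · simp [hfd]
    · simpa [hfd] using hIg
    · exact hI1 i
    · refine Continuous.integrable_of_hasCompactSupport ?_ hc.mul_left
      have := hg.continuous
      fun_prop
    · intro x _
      fun_prop
    · intro x _
      exact (hg.differentiable (by simp)) x
  have hsum : ∀ x, fderiv ℝ g x (x - p) + d * g x =
      ∑ i, ((x i - p i) * fderiv ℝ g x (e i) + g x) := fun x => by
    have hx : x - p = ∑ i, (x i - p i) • e i := by
      ext j
      simp [e, Finset.sum_apply, Pi.single_apply]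
    rw [Finset.sum_add_distrib]
    conv_lhs => rw [hx]
    simp
  simp_rw [hsum]
  refine (integral_finsetSum _ fun i _ => (hI1 i).add hIg).trans ?_
  exact Finset.sum_eq_zero fun i _ => key i

theorem hasDerivAt_max_zero_sq (t : ℝ) :
    HasDerivAt (fun t : ℝ => (max 0 t) ^ 2) (2 * max 0 t) t := by
  rcases lt_trichotomy t 0 with ht | rfl | ht
  · rw [max_eq_left ht.le, mul_zero]
    refine (hasDerivAt_const t (0 : ℝ)).congr_of_eventuallyEq ?_
    filter_upwards [gt_mem_nhds ht] with s hs
    simp [max_eq_left hs.le]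
  · rw [max_self, mul_zero, hasDerivAt_iff_isLittleO]
    have h1 : (fun x : ℝ => (max 0 x) ^ 2) =O[𝓝 0] fun x : ℝ => x ^ 2 := by
      refine Asymptotics.IsBigO.of_bound 1 (Eventually.of_forall fun x => ?_)
      rw [one_mul, Real.norm_of_nonneg (sq_nonneg _), Real.norm_of_nonneg (sq_nonneg _)]
      rcases max_cases 0 x with ⟨h, _⟩ | ⟨h, _⟩ <;> rw [h]
      nlinarith [sq_nonneg x]
    have h2 : (fun x : ℝ => x ^ 2) =o[𝓝 0] fun x : ℝ => x := by
      simpa using Asymptotics.isLittleO_pow_pow (𝕜 := ℝ) (m := 1) (n := 2) (by norm_num)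
    simpa using h1.trans_isLittleO h2
  · rw [max_eq_right ht.le]
    have : HasDerivAt (fun t : ℝ => t ^ 2) (2 * t) t := by simpa using hasDerivAt_pow 2 t
    refine this.congr_of_eventuallyEq ?_
    filter_upwards [lt_mem_nhds ht] with s hs
    simp [max_eq_right hs.le]

theorem contDiff_max_zero_sq : ContDiff ℝ 1 fun t : ℝ => (max 0 t) ^ 2 := by
  rw [contDiff_one_iff_deriv]
  refine ⟨fun t => (hasDerivAt_max_zero_sq t).differentiableAt, ?_⟩
  rw [funext fun t => (hasDerivAt_max_zero_sq t).deriv]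
  fun_prop

/-- Completing the square: `∫ ‖∇u + u ψ (x - p)‖² ≥ 0` over the ball, where the cross term is
integrated by parts. -/
theorem integral_weight_mul_sq_le {d : ℕ} {u ψ : EuclideanSpace ℝ (Fin d) → ℝ}
    (hu : ContDiff ℝ ∞ u) (hc : HasCompactSupport u) (hψ : ContDiff ℝ 1 ψ)
    (p : EuclideanSpace ℝ (Fin d)) (ρ : ℝ) (hψ0 : ∀ x ∉ Metric.ball p ρ, ψ x = 0) :
    ∫ x, (fderiv ℝ ψ x (x - p) + d * ψ x - ψ x ^ 2 * ‖x - p‖ ^ 2) * u x ^ 2 ≤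
      ∫ x in Metric.ball p ρ, ‖fderiv ℝ u x‖ ^ 2 := by
  have hu1 : ContDiff ℝ 1 u := hu.of_le (by simp)
  have hucont := hu1.continuous
  have hψcont := hψ.continuous
  have hDu : Continuous (fderiv ℝ u) := hu1.continuous_fderiv (by simp)
  have hDψ : Continuous (fderiv ℝ ψ) := hψ.continuous_fderiv (by simp)
  have hcu2 := hasCompactSupport_sq hc
  have hcDu2 := hasCompactSupport_norm_fderiv_sq hc
  have hL := integral_fderiv_apply_sub_add (hψ.mul (hu1.pow 2))
    (hcu2.mul_left (f := ψ)) p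
  have hfd : ∀ x, fderiv ℝ (fun x => ψ x * u x ^ 2) x (x - p) =
      fderiv ℝ ψ x (x - p) * u x ^ 2 + 2 * ψ x * u x * fderiv ℝ u x (x - p) := fun x => by
    have h1 := (hψ.differentiable (by simp) x).hasFDerivAt
    have h2 := (hu1.differentiable (by simp) x).hasFDerivAt
    have h3 : HasFDerivAt (fun x => ψ x * u x ^ 2) _ x := h1.mul (h2.pow 2)
    rw [h3.fderiv]
    simp
    ring
  have hI1 : Integrable fun x => fderiv ℝ (fun x => ψ x * u x ^ 2) x (x - p) + d * (ψ x * u x ^ 2) := by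
    simp_rw [hfd]
    refine Continuous.integrable_of_hasCompactSupport (by simp; fun_prop) ?_
    refine HasCompactSupport.add (HasCompactSupport.add hcu2.mul_left ?_)
      (HasCompactSupport.mul_left (hcu2.mul_left))
    exact (hc.mul_left (f := fun x => 2 * ψ x)).mul_right
  have hI2 : Integrable fun x =>
      (fderiv ℝ ψ x (x - p) + d * ψ x - ψ x ^ 2 * ‖x - p‖ ^ 2) * u x ^ 2 :=
    Continuous.integrable_of_hasCompactSupport (by fun_prop) hcu2.mul_left
  have hI3 : Integrable fun x => ‖fderiv ℝ u x‖ ^ 2 :=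
    Continuous.integrable_of_hasCompactSupport (by fun_prop) hcDu2
  have hI4 := hI3.indicator (measurableSet_ball (x := p) (ε := ρ))
  rw [← integral_indicator measurableSet_ball, ← sub_zero (∫ x, _), ← hL, ← integral_sub hI2 hI1]
  refine integral_mono (hI2.sub hI1) hI4 fun x => ?_
  simp only [hfd]
  by_cases hx : x ∈ Metric.ball p ρ
  · rw [indicator_of_mem hx]
    have h1 : |fderiv ℝ u x (x - p)| ≤ ‖fderiv ℝ u x‖ * ‖x - p‖ := (fderiv ℝ u x).le_opNorm _
    have h2 : -(ψ x * u x * fderiv ℝ u x (x - p)) ≤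
        ‖fderiv ℝ u x‖ * (|ψ x * u x| * ‖x - p‖) := by
      refine (neg_le_abs _).trans ?_
      rw [abs_mul]
      nlinarith [abs_nonneg (ψ x * u x)]
    have h3 : (|ψ x * u x| * ‖x - p‖) ^ 2 = ψ x ^ 2 * ‖x - p‖ ^ 2 * u x ^ 2 := by
      rw [mul_pow, sq_abs]; ring
    nlinarith [sq_nonneg (‖fderiv ℝ u x‖ - |ψ x * u x| * ‖x - p‖)]
  · rw [indicator_of_notMem hx, hψ0 x hx]
    simp

/-- The radial weight `c (1 - s / ρ²)₊² / (s + ε)` as a function of `s = |x - p|²`. It regularizes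
the weight `c / s` of the ground state `|x - p|^(-c)` at the pole and cuts it off at radius `ρ`. -/
noncomputable def hardyWeight (c ρ ε s : ℝ) : ℝ := c * ((max 0 (1 - s / ρ ^ 2)) ^ 2 / (s + ε))

theorem hasDerivAt_hardyWeight {c ρ ε s : ℝ} (hs : 0 ≤ s) (hε : 0 < ε) :
    HasDerivAt (hardyWeight c ρ ε)
      (c * ((2 * max 0 (1 - s / ρ ^ 2) * -(1 / ρ ^ 2) * (s + ε) - (max 0 (1 - s / ρ ^ 2)) ^ 2)
        / (s + ε) ^ 2)) s := by
  have h1 : HasDerivAt (fun s : ℝ => 1 - s / ρ ^ 2) (-(1 / ρ ^ 2)) s :=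
    ((hasDerivAt_id s).div_const (ρ ^ 2)).const_sub 1
  have h2 := (hasDerivAt_max_zero_sq (1 - s / ρ ^ 2)).comp s h1
  have h3 : HasDerivAt (fun s : ℝ => s + ε) 1 s := (hasDerivAt_id s).add_const ε
  have h4 := (h2.div h3 (by positivity)).const_mul c
  rw [mul_one] at h4
  exact h4

/-- The Riccati inequality for the regularized weight, with the constant `c²` of the unregularized
weight and an error that is uniform in `ε`. -/
theorem hardyWeight_riccati {c ρ ε s : ℝ} (hc : 0 ≤ c) (hρ : 0 < ρ) (hε : 0 < ε)
    (hs : 0 ≤ s) (hsρ : s < ρ ^ 2) :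
    c ^ 2 * (s / (s + ε) ^ 2) - (4 * c + 2 * c ^ 2) / ρ ^ 2 ≤
      deriv (hardyWeight c ρ ε) s * (2 * s) + (2 * c + 2) * hardyWeight c ρ ε s
        - hardyWeight c ρ ε s ^ 2 * s := by
  rw [(hasDerivAt_hardyWeight hs hε).deriv, hardyWeight]
  have hw1 : s / ρ ^ 2 < 1 := by rw [div_lt_one (by positivity)]; exact hsρ
  have hw0 : 0 ≤ s / ρ ^ 2 := by positivity
  rw [max_eq_right (by linarith : 0 ≤ 1 - s / ρ ^ 2)]
  obtain ⟨r, hr, hr'⟩ : ∃ r : ℝ, 0 < r ∧ 1 / ρ ^ 2 = r := ⟨_, by positivity, rfl⟩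
  obtain ⟨q, hq, hq'⟩ : ∃ q : ℝ, 0 < q ∧ 1 / (s + ε) = q := ⟨_, by positivity, rfl⟩
  have hqs : (s + ε) * q = 1 := by rw [← hq']; field_simp
  have hsq : s * q ≤ 1 := by nlinarith
  have hsq0 : 0 ≤ s * q := by positivity
  have hdr : ∀ y, y / ρ ^ 2 = y * r := fun y => by rw [← hr']; ring
  have hdq : ∀ y, y / (s + ε) = y * q := fun y => by rw [← hq']; ring
  have hdq2 : ∀ y, y / (s + ε) ^ 2 = y * q ^ 2 := fun y => by rw [← hq']; field_simp
  rw [hdr] at hw1 hw0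
  rw [hdr, hdr, hdq, hdq2, hdq2, hr']
  obtain ⟨θ, hθ⟩ : ∃ θ, θ = 1 - s * r := ⟨_, rfl⟩
  rw [← hθ]
  have hθ0 : 0 ≤ θ := by linarith
  have hθ1 : θ ≤ 1 := by linarith
  have e1 : (2 * θ * -r * (s + ε) - θ ^ 2) * q ^ 2 = -2 * θ * r * q - θ ^ 2 * q ^ 2 := by
    linear_combination (-2 * θ * r * q) * hqs
  rw [e1]
  have t1 : 4 * c * θ * r * (s * q) ≤ 4 * c * r := by
    have : θ * (s * q) ≤ 1 := by nlinarith
    have := mul_le_mul_of_nonneg_left this (by positivity : 0 ≤ 4 * c * r)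
    linarith
  have t2 : 0 ≤ (q - s * q ^ 2) * ((2 * c + 2) * c * θ ^ 2) := by
    have : 0 ≤ q - s * q ^ 2 := by nlinarith
    positivity
  have t3 : c ^ 2 * (s * q ^ 2) * (1 - θ ^ 2) ^ 2 ≤ 2 * c ^ 2 * r := by
    have hθ2 : 1 - θ ^ 2 ≤ 2 * (s * r) := by nlinarith
    have hθ3 : (1 - θ ^ 2) ^ 2 ≤ 2 * (s * r) := by
      have : 0 ≤ 1 - θ ^ 2 := by nlinarith
      nlinarith [sq_nonneg θ]
    calc c ^ 2 * (s * q ^ 2) * (1 - θ ^ 2) ^ 2 ≤ c ^ 2 * (s * q ^ 2) * (2 * (s * r)) := by gcongr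
      _ = 2 * c ^ 2 * r * (s * q) ^ 2 := by ring
      _ ≤ 2 * c ^ 2 * r * 1 := by
        gcongr
        exact pow_le_one₀ hsq0 hsq
      _ = 2 * c ^ 2 * r := by ring
  nlinarith [t1, t2, t3]

theorem contDiff_hardyWeight {d : ℕ} (c ρ : ℝ) {ε : ℝ} (hε : 0 < ε)
    (p : EuclideanSpace ℝ (Fin d)) :
    ContDiff ℝ 1 fun x => hardyWeight c ρ ε (‖x - p‖ ^ 2) := by
  unfold hardyWeight
  have h1 : ContDiff ℝ 1 fun x => ‖x - p‖ ^ 2 := (contDiff_id.sub contDiff_const).norm_sq ℝ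
  refine contDiff_const.mul (ContDiff.div ?_ (h1.add contDiff_const) fun x => by positivity)
  exact contDiff_max_zero_sq.comp (contDiff_const.sub (h1.div_const _))

/-- The regularized Hardy inequality in a ball. -/
theorem integral_regularized_le {d : ℕ} {u : EuclideanSpace ℝ (Fin d) → ℝ}
    (hu : ContDiff ℝ ∞ u) (hc : HasCompactSupport u) {c ρ ε : ℝ} (hc0 : 0 ≤ c)
    (hcd : (d : ℝ) = 2 * c + 2) (hρ : 0 < ρ) (hε : 0 < ε) (p : EuclideanSpace ℝ (Fin d)) :
    ∫ x in Metric.ball p ρ, c ^ 2 * (‖x - p‖ ^ 2 / (‖x - p‖ ^ 2 + ε) ^ 2) * u x ^ 2 ≤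
      ∫ x in Metric.ball p ρ,
        (‖fderiv ℝ u x‖ ^ 2 + (4 * c + 2 * c ^ 2) / ρ ^ 2 * u x ^ 2) := by
  set K := (4 * c + 2 * c ^ 2) / ρ ^ 2 with hK
  have hψ := contDiff_hardyWeight c ρ hε p
  have hψ0 : ∀ x ∉ Metric.ball p ρ, hardyWeight c ρ ε (‖x - p‖ ^ 2) = 0 := fun x hx => by
    rw [Metric.mem_ball, dist_eq_norm, not_lt] at hx
    have : 1 ≤ ‖x - p‖ ^ 2 / ρ ^ 2 := by
      rw [one_le_div (by positivity)]
      gcongr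
    simp [hardyWeight, max_eq_left (by linarith : 1 - ‖x - p‖ ^ 2 / ρ ^ 2 ≤ 0)]
  have hfd : ∀ x, fderiv ℝ (fun x => hardyWeight c ρ ε (‖x - p‖ ^ 2)) x (x - p) =
      deriv (hardyWeight c ρ ε) (‖x - p‖ ^ 2) * (2 * ‖x - p‖ ^ 2) := fun x => by
    have h1 : HasFDerivAt (fun x => ‖x - p‖ ^ 2) _ x :=
      ((hasFDerivAt_id x).sub_const p).norm_sq
    have h2 := (hasDerivAt_hardyWeight (c := c) (ρ := ρ) (sq_nonneg ‖x - p‖) hε)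
    rw [← h2.differentiableAt.hasDerivAt.unique h2] at h2
    have h3 := h2.comp_hasFDerivAt x h1
    rw [Function.comp_def] at h3
    rw [h3.fderiv]
    simp [-map_sub]
  have hu1 : ContDiff ℝ 1 u := hu.of_le (by simp)
  have hucont := hu1.continuous
  have hDu : Continuous (fderiv ℝ u) := hu1.continuous_fderiv (by simp)
  have hDψ := hψ.continuous_fderiv (by simp)
  have hψcont := hψ.continuous
  have hcu2 := hasCompactSupport_sq hc
  have hcDu2 := hasCompactSupport_norm_fderiv_sq hc
  have hI1 : Integrable fun x => ‖fderiv ℝ u x‖ ^ 2 :=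
    Continuous.integrable_of_hasCompactSupport (by fun_prop) hcDu2
  have hI2 : Integrable fun x => u x ^ 2 :=
    Continuous.integrable_of_hasCompactSupport (by fun_prop) hcu2
  have hI3 : Integrable fun x => c ^ 2 * (‖x - p‖ ^ 2 / (‖x - p‖ ^ 2 + ε) ^ 2) * u x ^ 2 := by
    refine Continuous.integrable_of_hasCompactSupport ?_ hcu2.mul_left
    refine (continuous_const.mul (Continuous.div (by fun_prop) (by fun_prop) ?_)).mul
      (hucont.pow 2)
    exact fun x => by positivity
  have hI4 : Integrable fun x => (fderiv ℝ (fun x => hardyWeight c ρ ε (‖x - p‖ ^ 2)) x (x - p)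
      + d * hardyWeight c ρ ε (‖x - p‖ ^ 2)
      - hardyWeight c ρ ε (‖x - p‖ ^ 2) ^ 2 * ‖x - p‖ ^ 2) * u x ^ 2 :=
    Continuous.integrable_of_hasCompactSupport (by fun_prop) hcu2.mul_left
  have hmain := integral_weight_mul_sq_le hu hc hψ p ρ hψ0
  rw [integral_add hI1.integrableOn (hI2.const_mul K).integrableOn, ← sub_le_iff_le_add,
    ← integral_sub hI3.integrableOn (hI2.const_mul K).integrableOn]
  refine le_trans ?_ hmain
  rw [← integral_indicator measurableSet_ball]
  refine integral_mono ((hI3.sub (hI2.const_mul K)).indicator measurableSet_ball) hI4 fun x => ?_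
  by_cases hx : x ∈ Metric.ball p ρ
  · rw [indicator_of_mem hx]
    dsimp only
    rw [← sub_mul, hfd, hcd]
    rw [Metric.mem_ball, dist_eq_norm] at hx
    exact mul_le_mul_of_nonneg_right
      (hardyWeight_riccati hc0 hρ hε (sq_nonneg _) (by gcongr)) (sq_nonneg _)
  · have hev : fderiv ℝ (fun x => hardyWeight c ρ ε (‖x - p‖ ^ 2)) x (x - p) = 0 := by
      rw [hfd, (hasDerivAt_hardyWeight (sq_nonneg _) hε).deriv]
      rw [Metric.mem_ball, dist_eq_norm, not_lt] at hx
      have : 1 ≤ ‖x - p‖ ^ 2 / ρ ^ 2 := by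
        rw [one_le_div (by positivity)]
        gcongr
      simp [max_eq_left (by linarith : 1 - ‖x - p‖ ^ 2 / ρ ^ 2 ≤ 0)]
    rw [indicator_of_notMem hx]
    dsimp only
    rw [hev, hψ0 x hx]
    simp

/-- Hardy's inequality in a ball around the pole `p`, with the sharp constant
`c² = (d - 2)² / 4` and a lower order term that depends on the radius only. -/
theorem lintegral_hardy_ball_le {d : ℕ} {u : EuclideanSpace ℝ (Fin d) → ℝ}
    (hu : ContDiff ℝ ∞ u) (hc : HasCompactSupport u) {c ρ : ℝ} (hc0 : 0 ≤ c)
    (hcd : (d : ℝ) = 2 * c + 2) (hρ : 0 < ρ) (p : EuclideanSpace ℝ (Fin d)) :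
    ∫⁻ x in Metric.ball p ρ, ENNReal.ofReal (c ^ 2 * (1 / ‖x - p‖ ^ 2) * u x ^ 2) ≤
      ∫⁻ x in Metric.ball p ρ,
        ENNReal.ofReal (‖fderiv ℝ u x‖ ^ 2 + (4 * c + 2 * c ^ 2) / ρ ^ 2 * u x ^ 2) := by
  set K := (4 * c + 2 * c ^ 2) / ρ ^ 2 with hK
  have hK0 : 0 ≤ K := by positivity
  have hucont := hu.continuous
  have hDu : Continuous (fderiv ℝ u) := hu.continuous_fderiv (by simp)
  have hcu2 := hasCompactSupport_sq hc
  have hcDu2 := hasCompactSupport_norm_fderiv_sq hc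
  have hI1 : Integrable fun x => ‖fderiv ℝ u x‖ ^ 2 + K * u x ^ 2 :=
    Continuous.integrable_of_hasCompactSupport (by fun_prop) (hcDu2.add hcu2.mul_left)
  let ε : ℕ → ℝ := fun n => 1 / ((n : ℝ) + 1)
  have hε : ∀ n, 0 < ε n := fun n => by positivity
  let F : ℕ → EuclideanSpace ℝ (Fin d) → ℝ := fun n x =>
    c ^ 2 * (‖x - p‖ ^ 2 / (‖x - p‖ ^ 2 + ε n) ^ 2) * u x ^ 2
  have hFcont : ∀ n, Continuous (F n) := fun n =>
    (continuous_const.mul (Continuous.div (by fun_prop) (by fun_prop) fun x =>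
      pow_ne_zero 2 (add_pos_of_nonneg_of_pos (sq_nonneg _) (hε n)).ne')).mul (hucont.pow 2)
  have hF0 : ∀ n x, 0 ≤ F n x := fun n x => by
    have := hε n
    positivity
  have hlim : ∀ x, Tendsto (fun n => ENNReal.ofReal (F n x)) atTop
      (𝓝 (ENNReal.ofReal (c ^ 2 * (1 / ‖x - p‖ ^ 2) * u x ^ 2))) := fun x => by
    refine ENNReal.tendsto_ofReal (Tendsto.mul_const _ (Tendsto.const_mul _ ?_))
    rcases eq_or_ne (‖x - p‖ ^ 2) 0 with h0 | h0
    -- At the pole both weights are zero: `s / (s + ε)²` vanishes there, and `1 / 0 = 0`.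
    · simp [h0]
    · have h1 : Tendsto (fun n => ‖x - p‖ ^ 2 / (‖x - p‖ ^ 2 + ε n) ^ 2) atTop
          (𝓝 (‖x - p‖ ^ 2 / (‖x - p‖ ^ 2 + 0) ^ 2)) :=
        tendsto_const_nhds.div ((tendsto_const_nhds.add
          (tendsto_one_div_add_atTop_nhds_zero_nat (𝕜 := ℝ))).pow 2) (by simpa using h0)
      have h2 : ‖x - p‖ ^ 2 / (‖x - p‖ ^ 2 + 0) ^ 2 = 1 / ‖x - p‖ ^ 2 := by
        rw [add_zero]
        field_simp
      rwa [h2] at h1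
  calc ∫⁻ x in Metric.ball p ρ, ENNReal.ofReal (c ^ 2 * (1 / ‖x - p‖ ^ 2) * u x ^ 2)
      = ∫⁻ x in Metric.ball p ρ, liminf (fun n => ENNReal.ofReal (F n x)) atTop :=
        lintegral_congr fun x => (hlim x).liminf_eq.symm
    _ ≤ liminf (fun n => ∫⁻ x in Metric.ball p ρ, ENNReal.ofReal (F n x)) atTop :=
        lintegral_liminf_le fun n => (hFcont n).measurable.ennreal_ofReal
    _ ≤ liminf (fun _ : ℕ => ∫⁻ x in Metric.ball p ρ,
          ENNReal.ofReal (‖fderiv ℝ u x‖ ^ 2 + K * u x ^ 2)) atTop := by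
        refine liminf_le_liminf (Eventually.of_forall fun n => ?_)
        have hFI : Integrable (F n) :=
          (hFcont n).integrable_of_hasCompactSupport hcu2.mul_left
        rw [← ofReal_integral_eq_lintegral_ofReal hFI.integrableOn
          (Eventually.of_forall (hF0 n)), ← ofReal_integral_eq_lintegral_ofReal hI1.integrableOn
          (Eventually.of_forall fun x => by positivity)]
        exact ENNReal.ofReal_le_ofReal (integral_regularized_le hu hc hc0 hcd hρ (hε n) p)
    _ = _ := by simp


/-! ### The potential near and away from its poles -/

theorem abs_apply_sub_le_norm {d : ℕ} (h : ℝ) (x : EuclideanSpace ℝ (Fin d)) (i : Fin d) (k : ℤ) :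
    |x i - k * h| ≤ ‖x - (k : ℝ) • hbar d h‖ := by
  simpa [hbar] using PiLp.norm_apply_le (x - (k : ℝ) • hbar d h) i

theorem exists_abs_apply_sub_le {d : ℕ} {h : ℝ} (hh : 0 < h) (x : EuclideanSpace ℝ (Fin d))
    (i : Fin d) : ∃ k : ℤ, |x i - k * h| ≤ h / 2 := by
  refine ⟨round (x i / h), ?_⟩
  have h1 := abs_sub_round (x i / h)
  have h2 : x i - round (x i / h) * h = (x i / h - round (x i / h)) * h := by
    field_simp
  rw [h2, abs_mul, abs_of_pos hh]
  nlinarith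

/-- A coordinate bounds the distance to every pole but the nearest one from below. -/
theorem one_div_norm_sq_le {d : ℕ} {h : ℝ} (hh : 0 < h) {x : EuclideanSpace ℝ (Fin d)} {i : Fin d}
    {k₀ k : ℤ} (hx : |x i - k₀ * h| ≤ h / 2) (hk : k ≠ k₀) :
    1 / ‖x - (k : ℝ) • hbar d h‖ ^ 2 ≤ 4 / h ^ 2 * (1 / ((k - k₀ : ℤ) : ℝ) ^ 2) := by
  have h1 : (1 : ℝ) ≤ |((k - k₀ : ℤ) : ℝ)| := by
    rw [← Int.cast_abs]
    exact_mod_cast Int.one_le_abs (sub_ne_zero.2 hk)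
  have h2 : |((k - k₀ : ℤ) : ℝ)| * h ≤ |x i - k₀ * h| + |x i - k * h| := by
    rw [← abs_of_pos hh, ← abs_mul, abs_of_pos hh]
    have : ((k - k₀ : ℤ) : ℝ) * h = (x i - k₀ * h) - (x i - k * h) := by push_cast; ring
    rw [this]
    exact abs_sub _ _
  have h3 : |((k - k₀ : ℤ) : ℝ)| * h / 2 ≤ ‖x - (k : ℝ) • hbar d h‖ := by
    have := abs_apply_sub_le_norm h x i k
    nlinarith
  have h4 : 0 < |((k - k₀ : ℤ) : ℝ)| * h / 2 := by positivity
  calc 1 / ‖x - (k : ℝ) • hbar d h‖ ^ 2 ≤ 1 / (|((k - k₀ : ℤ) : ℝ)| * h / 2) ^ 2 := by gcongr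
    _ = 4 / h ^ 2 * (1 / ((k - k₀ : ℤ) : ℝ) ^ 2) := by
      rw [div_pow, mul_pow, sq_abs]
      field_simp
      norm_num

/-- The series of `potential` converges, and apart from the term of the nearest pole its sum is
bounded uniformly in `x`. -/
theorem summable_and_potential_le {d : ℕ} {h : ℝ} (hh : 0 < h) {x : EuclideanSpace ℝ (Fin d)}
    {i : Fin d} {k₀ : ℤ} (hx : |x i - k₀ * h| ≤ h / 2) :
    (Summable fun k : ℤ => 1 / ‖x - (k : ℝ) • hbar d h‖ ^ 2) ∧
      potential d h x ≤
        1 / ‖x - (k₀ : ℝ) • hbar d h‖ ^ 2 + 4 / h ^ 2 * ∑' k : ℤ, 1 / (k : ℝ) ^ 2 := by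
  have hsum : Summable fun k : ℤ => 1 / (k : ℝ) ^ 2 :=
    Real.summable_one_div_int_pow.2 (by norm_num)
  have h1 : HasSum (fun k : ℤ => 4 / h ^ 2 * (1 / ((k - k₀ : ℤ) : ℝ) ^ 2))
      (4 / h ^ 2 * ∑' k : ℤ, 1 / (k : ℝ) ^ 2) :=
    ((Equiv.hasSum_iff (Equiv.subRight k₀)).2 hsum.hasSum).mul_left _
  have h2 := (hasSum_ite_eq k₀ (1 / ‖x - (k₀ : ℝ) • hbar d h‖ ^ 2)).add h1
  have hle : ∀ k : ℤ, 1 / ‖x - (k : ℝ) • hbar d h‖ ^ 2 ≤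
      (if k = k₀ then 1 / ‖x - (k₀ : ℝ) • hbar d h‖ ^ 2 else 0) +
        4 / h ^ 2 * (1 / ((k - k₀ : ℤ) : ℝ) ^ 2) := fun k => by
    split_ifs with hk
    · rw [hk]
      exact le_add_of_nonneg_right (by positivity)
    · rw [zero_add]
      exact one_div_norm_sq_le hh hx hk
  have hS := Summable.of_nonneg_of_le (fun k => by positivity) hle h2.summable
  exact ⟨hS, (hS.tsum_le_tsum hle h2.summable).trans h2.tsum_eq.le⟩

theorem summable_potential {d : ℕ} {h : ℝ} (hh : 0 < h) (i : Fin d)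
    (x : EuclideanSpace ℝ (Fin d)) :
    Summable fun k : ℤ => 1 / ‖x - (k : ℝ) • hbar d h‖ ^ 2 :=
  (summable_and_potential_le hh (exists_abs_apply_sub_le hh x i).choose_spec).1

theorem potential_nonneg (d : ℕ) (h : ℝ) (x : EuclideanSpace ℝ (Fin d)) : 0 ≤ potential d h x :=
  tsum_nonneg fun k => by positivity

theorem one_div_norm_sq_le_potential {d : ℕ} {h : ℝ} (hh : 0 < h) (i : Fin d)
    (x : EuclideanSpace ℝ (Fin d)) : 1 / ‖x‖ ^ 2 ≤ potential d h x := by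
  have h1 := (summable_potential hh i x).le_tsum 0 fun k _ => by positivity
  simp only [Int.cast_zero, zero_smul, sub_zero] at h1
  exact h1

theorem measurable_potential {d : ℕ} {h : ℝ} (hh : 0 < h) (i : Fin d) :
    Measurable (potential d h) := by
  refine measurable_of_tendsto_metrizable' (u := (atTop : Filter (Finset ℤ)))
    (f := fun s x => ∑ k ∈ s, 1 / ‖x - ((k : ℤ) : ℝ) • hbar d h‖ ^ 2)
    (fun s => Finset.measurable_fun_sum _ fun k _ => by fun_prop) ?_
  rw [tendsto_pi_nhds]
  exact fun x => (summable_potential hh i x).hasSum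

/-! ### The Hardy inequality for the lattice of poles -/

/-- The balls of radius `h / 2` around the poles are disjoint, so that the inequalities in these
balls add up. -/
theorem lintegral_potential_le {d : ℕ} {h : ℝ} (hh : 0 < h) (i : Fin d) {c : ℝ} (hc0 : 0 ≤ c)
    (hcd : (d : ℝ) = 2 * c + 2) :
    ∃ C : ℝ, 0 ≤ C ∧ ∀ u : EuclideanSpace ℝ (Fin d) → ℝ, ContDiff ℝ ∞ u → HasCompactSupport u →
      ∫⁻ x, ENNReal.ofReal (c ^ 2 * (potential d h x * u x ^ 2)) ≤
        ∫⁻ x, ENNReal.ofReal (‖fderiv ℝ u x‖ ^ 2 + C * u x ^ 2) := by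
  set S := ∑' k : ℤ, 1 / (k : ℝ) ^ 2
  have hS : 0 ≤ S := tsum_nonneg fun k => by positivity
  set K := (4 * c + 2 * c ^ 2) / (h / 2) ^ 2 with hK
  have hK0 : 0 ≤ K := by positivity
  set A := c ^ 2 * (4 / h ^ 2 + 4 / h ^ 2 * S) with hA
  have hA0 : 0 ≤ A := by positivity
  refine ⟨K + A, by positivity, fun u hu hc => ?_⟩
  have hucont := hu.continuous
  let B : ℤ → Set (EuclideanSpace ℝ (Fin d)) := fun k => Metric.ball ((k : ℝ) • hbar d h) (h / 2)
  have hBm : ∀ k, MeasurableSet (B k) := fun k => measurableSet_ball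
  have hBi : ∀ k, ∀ x ∈ B k, |x i - k * h| < h / 2 := fun k x hx =>
    (abs_apply_sub_le_norm h x i k).trans_lt (by simpa [B, dist_eq_norm] using hx)
  have hBd : Pairwise (Function.onFun Disjoint B) := fun k l hkl => by
    refine Set.disjoint_left.2 fun x hk hl => ?_
    have h1 := hBi k x hk
    have h2 := hBi l x hl
    have h3 : (1 : ℝ) ≤ |((k - l : ℤ) : ℝ)| := by
      rw [← Int.cast_abs]
      exact_mod_cast Int.one_le_abs (sub_ne_zero.2 hkl)
    have h4 : |((k - l : ℤ) : ℝ)| * h ≤ |x i - l * h| + |x i - k * h| := by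
      rw [← abs_of_pos hh, ← abs_mul, abs_of_pos hh]
      have : ((k - l : ℤ) : ℝ) * h = (x i - l * h) - (x i - k * h) := by push_cast; ring
      rw [this]
      exact abs_sub _ _
    nlinarith
  have hball : ∀ k, ∫⁻ x in B k, ENNReal.ofReal (c ^ 2 * (potential d h x * u x ^ 2)) ≤
      ∫⁻ x in B k, ENNReal.ofReal (‖fderiv ℝ u x‖ ^ 2 + (K + A) * u x ^ 2) := fun k => by
    have hm : Measurable fun x => ENNReal.ofReal (A * u x ^ 2) := by fun_prop
    calc ∫⁻ x in B k, ENNReal.ofReal (c ^ 2 * (potential d h x * u x ^ 2))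
        ≤ ∫⁻ x in B k, (ENNReal.ofReal (c ^ 2 * (1 / ‖x - (k : ℝ) • hbar d h‖ ^ 2) * u x ^ 2) +
            ENNReal.ofReal (A * u x ^ 2)) := by
          refine setLIntegral_mono' (hBm k) fun x hx => ?_
          rw [← ENNReal.ofReal_add (by positivity) (by positivity)]
          refine ENNReal.ofReal_le_ofReal ?_
          have h1 := (summable_and_potential_le hh (hBi k x hx).le).2
          have h2 : potential d h x ≤ 1 / ‖x - (k : ℝ) • hbar d h‖ ^ 2 +
              (4 / h ^ 2 + 4 / h ^ 2 * S) := by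
            have : 0 ≤ 4 / h ^ 2 := by positivity
            linarith
          calc c ^ 2 * (potential d h x * u x ^ 2)
              ≤ c ^ 2 * ((1 / ‖x - (k : ℝ) • hbar d h‖ ^ 2 +
                (4 / h ^ 2 + 4 / h ^ 2 * S)) * u x ^ 2) := by gcongr
            _ = _ := by rw [hA]; ring
      _ = (∫⁻ x in B k, ENNReal.ofReal (c ^ 2 * (1 / ‖x - (k : ℝ) • hbar d h‖ ^ 2) * u x ^ 2)) +
            ∫⁻ x in B k, ENNReal.ofReal (A * u x ^ 2) := lintegral_add_right _ hm
      _ ≤ (∫⁻ x in B k, ENNReal.ofReal (‖fderiv ℝ u x‖ ^ 2 + K * u x ^ 2)) +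
            ∫⁻ x in B k, ENNReal.ofReal (A * u x ^ 2) := by
          exact add_le_add_left (lintegral_hardy_ball_le hu hc hc0 hcd (by positivity) _) _
      _ = _ := by
          rw [← lintegral_add_right _ hm]
          refine lintegral_congr fun x => ?_
          rw [← ENNReal.ofReal_add (by positivity) (by positivity)]
          congr 1
          ring
  have hU : MeasurableSet (⋃ k, B k) := MeasurableSet.iUnion hBm
  rw [← lintegral_add_compl _ hU, ← lintegral_add_compl (fun x => ENNReal.ofReal (_ + _)) hU,
    lintegral_iUnion hBm hBd, lintegral_iUnion hBm hBd]
  refine add_le_add (ENNReal.tsum_le_tsum hball) (setLIntegral_mono' hU.compl fun x hx => ?_)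
  refine ENNReal.ofReal_le_ofReal ?_
  obtain ⟨k, hk⟩ := exists_abs_apply_sub_le hh x i
  have h1 := (summable_and_potential_le hh hk).2
  have h2 : h / 2 ≤ ‖x - (k : ℝ) • hbar d h‖ := by
    by_contra! h3
    exact hx (mem_iUnion.2 ⟨k, by simpa [B, dist_eq_norm] using h3⟩)
  have h3 : 1 / ‖x - (k : ℝ) • hbar d h‖ ^ 2 ≤ 4 / h ^ 2 := by
    calc 1 / ‖x - (k : ℝ) • hbar d h‖ ^ 2 ≤ 1 / (h / 2) ^ 2 := by gcongr
      _ = 4 / h ^ 2 := by field_simp; norm_num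
  calc c ^ 2 * (potential d h x * u x ^ 2)
      ≤ c ^ 2 * ((4 / h ^ 2 + 4 / h ^ 2 * S) * u x ^ 2) := by
        gcongr
        linarith
    _ = A * u x ^ 2 := by rw [hA]; ring
    _ ≤ ‖fderiv ℝ u x‖ ^ 2 + (K + A) * u x ^ 2 := by
        nlinarith [sq_nonneg ‖fderiv ℝ u x‖, mul_nonneg hK0 (sq_nonneg (u x))]

theorem integrable_sq {d : ℕ} {u : EuclideanSpace ℝ (Fin d) → ℝ} (hu : ContDiff ℝ ∞ u)
    (hc : HasCompactSupport u) : Integrable fun x => u x ^ 2 :=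
  (hu.continuous.pow 2).integrable_of_hasCompactSupport (hasCompactSupport_sq hc)

theorem integrable_norm_fderiv_sq {d : ℕ} {u : EuclideanSpace ℝ (Fin d) → ℝ}
    (hu : ContDiff ℝ ∞ u) (hc : HasCompactSupport u) :
    Integrable fun x => ‖fderiv ℝ u x‖ ^ 2 :=
  ((hu.continuous_fderiv (by simp)).norm.pow 2).integrable_of_hasCompactSupport
    (hasCompactSupport_norm_fderiv_sq hc)

theorem integral_potential_le {d : ℕ} {h : ℝ} (hh : 0 < h) (i : Fin d) {c : ℝ} (hc0 : 0 < c)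
    (hcd : (d : ℝ) = 2 * c + 2) :
    ∃ C : ℝ, ∀ u : EuclideanSpace ℝ (Fin d) → ℝ, ContDiff ℝ ∞ u → HasCompactSupport u →
      Integrable (fun x => potential d h x * u x ^ 2) ∧
        c ^ 2 * ∫ x, potential d h x * u x ^ 2 ≤
          C * (∫ x, u x ^ 2) + ∫ x, ‖fderiv ℝ u x‖ ^ 2 := by
  obtain ⟨C, hC0, hC⟩ := lintegral_potential_le hh i hc0.le hcd
  refine ⟨C, fun u hu hc => ?_⟩
  have hm : Measurable fun x => potential d h x * u x ^ 2 :=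
    (measurable_potential hh i).mul (hu.continuous.measurable.pow_const 2)
  have h0 : ∀ x, 0 ≤ potential d h x * u x ^ 2 := fun x =>
    mul_nonneg (potential_nonneg d h x) (sq_nonneg _)
  have h0' : ∀ x, 0 ≤ c ^ 2 * (potential d h x * u x ^ 2) := fun x =>
    mul_nonneg (sq_nonneg c) (h0 x)
  have h1 := integrable_sq hu hc
  have h2 := integrable_norm_fderiv_sq hu hc
  have h3 : Integrable fun x => ‖fderiv ℝ u x‖ ^ 2 + C * u x ^ 2 := h2.add (h1.const_mul C)
  have hle := hC u hu hc
  rw [← ofReal_integral_eq_lintegral_ofReal h3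
    (Eventually.of_forall fun x => by positivity)] at hle
  have hI : Integrable fun x => c ^ 2 * (potential d h x * u x ^ 2) :=
    (lintegral_ofReal_ne_top_iff_integrable (hm.const_mul _).aestronglyMeasurable
      (Eventually.of_forall h0')).1 (hle.trans_lt ENNReal.ofReal_lt_top).ne
  refine ⟨(integrable_const_mul_iff (isUnit_iff_ne_zero.2 (by positivity)) _).1 hI, ?_⟩
  rw [← ofReal_integral_eq_lintegral_ofReal hI (Eventually.of_forall h0'),
    ENNReal.ofReal_le_ofReal_iff (integral_nonneg fun x => by positivity)] at hle
  rw [integral_const_mul, integral_add h2 (h1.const_mul C), integral_const_mul] at hle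
  linarith

/-! ### Integrals over the cylinder -/

/-- On a set that contains the support of a test function, the integrals of the two inequalities
are integrals over the whole space. -/
theorem IsTestFunction.setIntegral_eq {d : ℕ} {Ω : Set (EuclideanSpace ℝ (Fin d))}
    {u : EuclideanSpace ℝ (Fin d) → ℝ} (hu : IsTestFunction Ω u)
    (V : EuclideanSpace ℝ (Fin d) → ℝ) :
    (∫ x in Ω, V x * u x ^ 2 = ∫ x, V x * u x ^ 2) ∧ (∫ x in Ω, u x ^ 2 = ∫ x, u x ^ 2) ∧
      ∫ x in Ω, ‖gradient u x‖ ^ 2 = ∫ x, ‖fderiv ℝ u x‖ ^ 2 := by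
  have h0 : ∀ x ∉ Ω, u x = 0 := fun x hx => image_eq_zero_of_notMem_tsupport fun h =>
    hx (hu.support h)
  have h1 : ∀ x, ‖gradient u x‖ = ‖fderiv ℝ u x‖ := fun x => by simp [gradient]
  have h2 : ∀ x ∉ Ω, fderiv ℝ u x = 0 := fun x hx => image_eq_zero_of_notMem_tsupport fun h =>
    hx (hu.support (tsupport_fderiv_subset ℝ h))
  refine ⟨setIntegral_eq_integral_of_forall_compl_eq_zero fun x hx => by simp [h0 x hx],
    setIntegral_eq_integral_of_forall_compl_eq_zero fun x hx => by simp [h0 x hx], ?_⟩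
  simp_rw [h1]
  exact setIntegral_eq_integral_of_forall_compl_eq_zero fun x hx => by simp [h2 x hx]


/-! ### Logarithmic polar coordinates -/

/-- Integration of a radial function in the variable `t = log ‖x‖`; `κ` is the area of the unit
sphere. -/
theorem exists_integral_comp_norm_eq {d : ℕ} (hd : 0 < d) :
    ∃ κ : ℝ, 0 < κ ∧ ∀ f : ℝ → ℝ, ∫ x : EuclideanSpace ℝ (Fin d), f ‖x‖ =
      κ * ∫ t : ℝ, Real.exp (d * t) * f (Real.exp t) := by
  have : Nonempty (Fin d) := ⟨⟨0, hd⟩⟩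
  refine ⟨d * volume.real (Metric.ball (0 : EuclideanSpace ℝ (Fin d)) 1), ?_, fun f => ?_⟩
  · have : 0 < volume.real (Metric.ball (0 : EuclideanSpace ℝ (Fin d)) 1) :=
      ENNReal.toReal_pos (Metric.measure_ball_pos _ _ one_pos).ne' measure_ball_lt_top.ne
    positivity
  · have h1 := integral_image_eq_integral_abs_deriv_smul (s := univ) (f := Real.exp)
      (f' := Real.exp) MeasurableSet.univ (fun x _ => (Real.hasDerivAt_exp x).hasDerivWithinAt)
      Real.exp_injective.injOn (fun y : ℝ => y ^ (d - 1) • f y)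
    rw [image_univ, Real.range_exp] at h1
    rw [integral_fun_norm_addHaar volume f, finrank_euclideanSpace_fin, h1, nsmul_eq_mul,
      smul_eq_mul, ← mul_assoc, setIntegral_univ]
    congr 1
    refine integral_congr_ae (Eventually.of_forall fun t => ?_)
    have h2 : Real.exp (d * t) = Real.exp t * Real.exp t ^ (d - 1) := by
      rw [← pow_succ', Nat.sub_add_cancel hd, Real.exp_nat_mul]
    simp only [Real.abs_exp, smul_eq_mul, h2, mul_assoc]

/-- The radial function `x ↦ H (log ‖x‖)` is smooth if `H` is smooth and vanishes outside `[a, b]`.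
The condition `b ≤ 0` makes `H 0 = 0`, which is the value at the origin since `log 0 = 0`. -/
theorem contDiff_comp_log_norm {d : ℕ} {H : ℝ → ℝ} {a b : ℝ} (hH : ContDiff ℝ ∞ H)
    (ha : ∀ t ≤ a, H t = 0) (hb : ∀ t, b ≤ t → H t = 0) (hb0 : b ≤ 0) :
    ContDiff ℝ ∞ (fun x : EuclideanSpace ℝ (Fin d) => H (Real.log ‖x‖)) ∧
      (fun x : EuclideanSpace ℝ (Fin d) => H (Real.log ‖x‖)) =ᶠ[𝓝 0] fun _ => 0 := by
  have h0 : (fun x : EuclideanSpace ℝ (Fin d) => H (Real.log ‖x‖)) =ᶠ[𝓝 0] fun _ => 0 := by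
    filter_upwards [Metric.ball_mem_nhds (0 : EuclideanSpace ℝ (Fin d)) (Real.exp_pos a)] with x hx
    rcases eq_or_ne x 0 with rfl | hx0
    · simpa using hb 0 hb0
    · refine ha _ ((Real.log_le_iff_le_exp (norm_pos_iff.2 hx0)).2 ?_)
      simpa using (mem_ball_zero_iff.1 hx).le
  refine ⟨contDiff_iff_contDiffAt.2 fun x => ?_, h0⟩
  rcases eq_or_ne x 0 with rfl | hx0
  · exact contDiffAt_const.congr_of_eventuallyEq h0
  · exact hH.contDiffAt.comp x ((contDiffAt_norm ℝ hx0).log (norm_ne_zero_iff.2 hx0))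

/-- At the origin both sides are zero, the right one because of the division by `‖x‖ = 0`. -/
theorem norm_fderiv_comp_log_norm {d : ℕ} {H : ℝ → ℝ} {a b : ℝ} (hH : ContDiff ℝ ∞ H)
    (ha : ∀ t ≤ a, H t = 0) (hb : ∀ t, b ≤ t → H t = 0) (hb0 : b ≤ 0)
    (x : EuclideanSpace ℝ (Fin d)) :
    ‖fderiv ℝ (fun x : EuclideanSpace ℝ (Fin d) => H (Real.log ‖x‖)) x‖ =
      |deriv H (Real.log ‖x‖)| / ‖x‖ := by
  rcases eq_or_ne x 0 with rfl | hx0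
  · rw [(contDiff_comp_log_norm hH ha hb hb0).2.fderiv_eq]
    simp
  · have hx : ‖x‖ ≠ 0 := norm_ne_zero_iff.2 hx0
    have h1 : HasFDerivAt (fun x : EuclideanSpace ℝ (Fin d) => ‖x‖ ^ 2) _ x :=
      (hasFDerivAt_id x).norm_sq
    have h2 := (h1.log (pow_ne_zero 2 hx)).const_mul (1 / 2)
    have h3 : (fun x : EuclideanSpace ℝ (Fin d) => 1 / 2 * Real.log (‖x‖ ^ 2)) =
        fun x => Real.log ‖x‖ := by
      ext y
      rw [Real.log_pow]
      push_cast
      ring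
    rw [h3] at h2
    have h4 := ((hH.differentiable (by simp) (Real.log ‖x‖)).hasDerivAt).comp_hasFDerivAt x h2
    rw [Function.comp_def] at h4
    rw [h4.fderiv]
    simp only [norm_smul, id, ContinuousLinearMap.comp_id, Real.norm_eq_abs]
    rw [← Nat.cast_smul_eq_nsmul ℝ, norm_smul, innerSL_apply_norm, abs_inv, abs_of_nonneg
      (sq_nonneg ‖x‖)]
    norm_num
    field_simp

/-! ### Almost optimal functions -/

/-- A bump function, stretched and translated: its derivative is small in `L²` relative to the
function, and its support lies to the left of `b`. -/
theorem exists_smooth_small_deriv {δ : ℝ} (hδ : 0 < δ) (b : ℝ) :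
    ∃ (θ : ℝ → ℝ) (a : ℝ), ContDiff ℝ ∞ θ ∧ (∀ t ≤ a, θ t = 0) ∧ (∀ t, b ≤ t → θ t = 0) ∧
      0 < ∫ t, θ t ^ 2 ∧ ∫ t, deriv θ t ^ 2 ≤ δ * ∫ t, θ t ^ 2 := by
  let χ : ContDiffBump (0 : ℝ) := ⟨1, 2, one_pos, one_lt_two⟩
  have hχ : ContDiff ℝ ∞ χ := χ.contDiff
  have hχd : Continuous (deriv χ) := hχ.continuous_deriv (by simp)
  set I := ∫ t, χ t ^ 2 with hI
  set J := ∫ t, deriv χ t ^ 2 with hJ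
  have hJ0 : 0 ≤ J := integral_nonneg fun t => sq_nonneg _
  have hI0 : 0 < I := by
    refine Continuous.integral_pos_of_hasCompactSupport_nonneg_nonzero (x := 0)
      (χ.continuous.pow 2) (hasCompactSupport_sq χ.hasCompactSupport) (fun t => sq_nonneg _) ?_
    have : χ 0 = 1 := χ.one_of_mem_closedBall (by simp [χ])
    simp [this]
  -- Stretching by the factor `1 / ε` multiplies `∫ χ'² / ∫ χ²` by `ε²`.
  obtain ⟨ε, hε, hεJ⟩ : ∃ ε : ℝ, 0 < ε ∧ ε ^ 2 * J ≤ δ * I := by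
    refine ⟨√(δ * I / (J + 1)), Real.sqrt_pos.2 (by positivity), ?_⟩
    rw [Real.sq_sqrt (by positivity), div_mul_eq_mul_div, div_le_iff₀ (by positivity)]
    nlinarith [mul_pos hδ hI0]
  have hcomp : ∀ g : ℝ → ℝ, ∫ t, g (ε * t + (2 - ε * b)) = ε⁻¹ * ∫ t, g t := fun g => by
    rw [Measure.integral_comp_mul_left (fun t => g (t + (2 - ε * b))) ε,
      integral_add_right_eq_self g, abs_of_pos (by positivity), smul_eq_mul]
  have hzero : ∀ t, 2 ≤ |t| → χ t = 0 := fun t ht => χ.zero_of_le_dist (by simpa [χ] using ht)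
  have hderiv : ∀ t, deriv (fun t => χ (ε * t + (2 - ε * b))) t =
      ε * deriv χ (ε * t + (2 - ε * b)) := fun t => by
    have h1 : HasDerivAt (fun t => ε * t + (2 - ε * b)) ε t := by
      simpa using ((hasDerivAt_id t).const_mul ε).add_const (2 - ε * b)
    have h2 := (hχ.differentiable (by simp) (ε * t + (2 - ε * b))).hasDerivAt.comp t h1
    exact h2.deriv.trans (mul_comm _ _)
  refine ⟨fun t => χ (ε * t + (2 - ε * b)), b - 4 / ε,
    hχ.comp ((contDiff_const.mul contDiff_id).add contDiff_const), fun t ht => hzero _ ?_,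
    fun t ht => hzero _ ?_, ?_, ?_⟩
  · have : ε * t ≤ ε * (b - 4 / ε) := by gcongr
    have h4 : ε * (b - 4 / ε) = ε * b - 4 := by field_simp
    exact le_abs.2 (Or.inr (by linarith))
  · have : ε * b ≤ ε * t := by gcongr
    exact le_abs.2 (Or.inl (by linarith))
  · rw [hcomp fun t => χ t ^ 2]
    positivity
  · simp_rw [hderiv, mul_pow]
    rw [integral_const_mul, hcomp fun t => deriv χ t ^ 2, hcomp fun t => χ t ^ 2, ← hI, ← hJ]
    have : 0 < ε⁻¹ := by positivity
    calc ε ^ 2 * (ε⁻¹ * J) = ε⁻¹ * (ε ^ 2 * J) := by ring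
      _ ≤ ε⁻¹ * (δ * I) := by gcongr
      _ = δ * (ε⁻¹ * I) := by ring

/-- The cross term is the integral of `(θ²)'`. -/
theorem integral_deriv_sub_mul_sq {θ : ℝ → ℝ} (hθ : ContDiff ℝ ∞ θ) (hc : HasCompactSupport θ)
    (c : ℝ) : ∫ t, (deriv θ t - c * θ t) ^ 2 = (∫ t, deriv θ t ^ 2) + c ^ 2 * ∫ t, θ t ^ 2 := by
  have hθc := hθ.continuous
  have hdc : Continuous (deriv θ) := hθ.continuous_deriv (by simp)
  have h1 : Integrable fun t => deriv θ t ^ 2 :=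
    (hdc.pow 2).integrable_of_hasCompactSupport (hasCompactSupport_sq hc.deriv)
  have h2 : Integrable fun t => θ t ^ 2 :=
    (hθc.pow 2).integrable_of_hasCompactSupport (hasCompactSupport_sq hc)
  have h3 : Integrable fun t => 2 * θ t * deriv θ t :=
    Continuous.integrable_of_hasCompactSupport (by fun_prop) hc.deriv.mul_left
  have h4 : ∫ t, 2 * θ t * deriv θ t = 0 :=
    integral_eq_zero_of_hasDerivAt_of_integrable (f := fun t => θ t ^ 2) (fun t => by
      have h := (hθ.differentiable (by simp) t).hasDerivAt.pow 2
      simp only [Nat.cast_ofNat, Nat.add_one_sub_one, pow_one] at h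
      exact h) h3 h2
  have h5 : ∀ t, (deriv θ t - c * θ t) ^ 2 =
      deriv θ t ^ 2 + c ^ 2 * θ t ^ 2 - c * (2 * θ t * deriv θ t) := fun t => by ring
  simp_rw [h5]
  have h6 : Integrable fun t => deriv θ t ^ 2 + c ^ 2 * θ t ^ 2 := h1.add (h2.const_mul _)
  rw [integral_sub h6 (h3.const_mul _), integral_add h1 (h2.const_mul _),
    integral_const_mul, integral_const_mul, h4]
  ring

/-- Sharpness of the constant `c²`: with `u(x) = ‖x‖^(-c) θ(log ‖x‖)` the quotient of Hardy's
inequality at the origin is `c² + ∫ θ'² / ∫ θ²`, and `u` may be supported in any ball. -/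
theorem exists_almost_optimal {d : ℕ} (hd : 0 < d) {c : ℝ} (hcd : (d : ℝ) = 2 * c + 2) {δ r : ℝ}
    (hδ : 0 < δ) (hr : 0 < r) (hr1 : r ≤ 1) :
    ∃ (u : EuclideanSpace ℝ (Fin d) → ℝ) (M : ℝ), 0 < M ∧ ContDiff ℝ ∞ u ∧
      tsupport u ⊆ Metric.closedBall 0 r ∧ ∫ x, 1 / ‖x‖ ^ 2 * u x ^ 2 = M ∧ ∫ x, u x ^ 2 ≤ r ^ 2 * M ∧
      ∫ x, ‖fderiv ℝ u x‖ ^ 2 ≤ (c ^ 2 + δ) * M := by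
  obtain ⟨κ, hκ, hpolar⟩ := exists_integral_comp_norm_eq hd
  obtain ⟨θ, a, hθ, hθa, hθb, hθ0, hθd⟩ := exists_smooth_small_deriv hδ (Real.log r)
  have hc : HasCompactSupport θ := HasCompactSupport.intro (isCompact_Icc (a := a) (b := Real.log r))
    fun t ht => by
      rw [mem_Icc, not_and_or, not_le, not_le] at ht
      exact ht.elim (fun h => hθa t h.le) fun h => hθb t h.le
  have hθI : Integrable fun t => θ t ^ 2 :=
    (hθ.continuous.pow 2).integrable_of_hasCompactSupport (hasCompactSupport_sq hc)
  have hb0 : Real.log r ≤ 0 := Real.log_nonpos hr.le hr1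
  let H : ℝ → ℝ := fun t => Real.exp (-c * t) * θ t
  have hH : ContDiff ℝ ∞ H := (contDiff_const.mul contDiff_id).exp.mul hθ
  have hHa : ∀ t ≤ a, H t = 0 := fun t ht => by simp [H, hθa t ht]
  have hHb : ∀ t, Real.log r ≤ t → H t = 0 := fun t ht => by simp [H, hθb t ht]
  have hH' : ∀ t, deriv H t = Real.exp (-c * t) * (deriv θ t - c * θ t) := fun t => by
    have h1 : HasDerivAt (fun t => -c * t) (-c) t := by
      simpa using (hasDerivAt_id t).const_mul (-c)
    have h2 := h1.exp.mul (hθ.differentiable (by simp) t).hasDerivAt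
    refine h2.deriv.trans ?_
    ring
  have hexp : ∀ t, Real.exp (d * t) * (Real.exp (-c * t) ^ 2 / Real.exp t ^ 2) = 1 := fun t => by
    rw [← Real.exp_nat_mul, ← Real.exp_nat_mul, ← Real.exp_sub, ← Real.exp_add, hcd]
    push_cast
    ring_nf
    exact Real.exp_zero
  have hout : ∀ x : EuclideanSpace ℝ (Fin d), r ≤ ‖x‖ → H (Real.log ‖x‖) = 0 := fun x hx =>
    hHb _ (Real.log_le_log hr hx)
  refine ⟨fun x => H (Real.log ‖x‖), κ * ∫ t, θ t ^ 2, by positivity,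
    (contDiff_comp_log_norm hH hHa hHb hb0).1, ?_, ?_, ?_, ?_⟩
  · refine closure_minimal (fun x hx => ?_) Metric.isClosed_closedBall
    rw [mem_closedBall_zero_iff]
    by_contra! h
    exact hx (hout x h.le)
  · rw [hpolar fun s => 1 / s ^ 2 * H (Real.log s) ^ 2]
    congr 1
    refine integral_congr_ae (Eventually.of_forall fun t => ?_)
    simp only [Real.log_exp, H]
    linear_combination θ t ^ 2 * hexp t
  · rw [hpolar fun s => H (Real.log s) ^ 2, mul_left_comm, ← integral_const_mul (r ^ 2)]
    refine mul_le_mul_of_nonneg_left ?_ hκ.le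
    refine integral_mono_of_nonneg (Eventually.of_forall fun t => by positivity)
      (hθI.const_mul _) (Eventually.of_forall fun t => ?_)
    have h1 : Real.exp (d * t) * H (Real.log (Real.exp t)) ^ 2 = Real.exp t ^ 2 * θ t ^ 2 := by
      have h2 := hexp t
      rw [← mul_div_assoc, div_eq_iff (by positivity), one_mul] at h2
      simp only [Real.log_exp, H]
      linear_combination θ t ^ 2 * h2
    dsimp only
    rw [h1]
    rcases le_total (Real.log r) t with ht | ht
    · simp [hθb t ht]
    · have : Real.exp t ≤ r := (Real.le_log_iff_exp_le hr).1 ht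
      gcongr
  · simp_rw [norm_fderiv_comp_log_norm hH hHa hHb hb0]
    rw [hpolar fun s => (|deriv H (Real.log s)| / s) ^ 2]
    have h1 : ∀ t, Real.exp (d * t) * (|deriv H (Real.log (Real.exp t))| / Real.exp t) ^ 2 =
        (deriv θ t - c * θ t) ^ 2 := fun t => by
      rw [div_pow, sq_abs, Real.log_exp, hH']
      linear_combination (deriv θ t - c * θ t) ^ 2 * hexp t
    simp_rw [h1]
    rw [integral_deriv_sub_mul_sq hθ hc]
    nlinarith

theorem closedBall_subset_cylinder {d : ℕ} {r R : ℝ} (hr : r < R) :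
    Metric.closedBall 0 r ⊆ cylinder d R := fun x hx => by
  have h0 : (0 : EuclideanSpace ℝ (Fin d)) ∈ axis d := fun i j => by simp
  exact ((Metric.infDist_le_dist_of_mem h0).trans hx).trans_lt hr

end HardyCylinder

theorem theorem3 (d : ℕ) (hd : 3 ≤ d) (h R : ℝ) (hh : 0 < h) (hR : 0 < R) :
    (∃ C : ℝ, ∀ u : EuclideanSpace ℝ (Fin d) → ℝ,
      HardyCylinder.IsTestFunction (HardyCylinder.cylinder d R) u →
        IntegrableOn (fun x => HardyCylinder.potential d h x * u x ^ 2)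
          (HardyCylinder.cylinder d R) volume ∧
        ((d : ℝ) - 2) ^ 2 / 4 *
            ∫ x in HardyCylinder.cylinder d R, HardyCylinder.potential d h x * u x ^ 2 ≤
          C * (∫ x in HardyCylinder.cylinder d R, u x ^ 2) +
            ∫ x in HardyCylinder.cylinder d R, ‖gradient u x‖ ^ 2) ∧
    (∀ μ : ℝ, ((d : ℝ) - 2) ^ 2 / 4 < μ → ∀ lam : ℝ,
      ∃ u : EuclideanSpace ℝ (Fin d) → ℝ,
        HardyCylinder.IsTestFunction (HardyCylinder.cylinder d R) u ∧
        IntegrableOn (fun x => HardyCylinder.potential d h x * u x ^ 2)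
          (HardyCylinder.cylinder d R) volume ∧
        lam * (∫ x in HardyCylinder.cylinder d R, u x ^ 2) +
            ∫ x in HardyCylinder.cylinder d R, ‖gradient u x‖ ^ 2 <
          μ * ∫ x in HardyCylinder.cylinder d R, HardyCylinder.potential d h x * u x ^ 2) := by
  obtain ⟨c, hc⟩ : ∃ c : ℝ, c = ((d : ℝ) - 2) / 2 := ⟨_, rfl⟩
  have hd' : (3 : ℝ) ≤ d := by exact_mod_cast hd
  have hc0 : 0 < c := by linarith
  have hcd : (d : ℝ) = 2 * c + 2 := by linarith
  have hcc : ((d : ℝ) - 2) ^ 2 / 4 = c ^ 2 := by rw [hc]; ring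
  rw [hcc]
  let i : Fin d := ⟨0, by omega⟩
  obtain ⟨C, hC⟩ := HardyCylinder.integral_potential_le hh i hc0 hcd
  refine ⟨⟨C, fun u hu => ?_⟩, fun μ hμ lam => ?_⟩
  · obtain ⟨h1, h2⟩ := hC u hu.smooth hu.compact
    obtain ⟨e1, e2, e3⟩ := hu.setIntegral_eq (HardyCylinder.potential d h)
    refine ⟨h1.integrableOn, ?_⟩
    rwa [e1, e2, e3]
  · -- The radius makes `|lam| ∫ u²` at most a quarter of `(μ - c²) ∫ u² / ‖x‖²`.
    obtain ⟨r, hr0, hr1, hrR, hrl⟩ : ∃ r : ℝ, 0 < r ∧ r ≤ 1 ∧ r < R ∧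
        (|lam| + 1) * r ≤ (μ - c ^ 2) / 4 := by
      have hη : 0 < (μ - c ^ 2) / 4 := by linarith
      refine ⟨min 1 (min (R / 2) ((μ - c ^ 2) / 4 / (|lam| + 1))), by positivity,
        min_le_left _ _, ?_, ?_⟩
      · exact ((min_le_right _ _).trans (min_le_left _ _)).trans_lt (by linarith)
      · rw [mul_comm, ← le_div_iff₀ (by positivity)]
        exact (min_le_right _ _).trans (min_le_right _ _)
    obtain ⟨u, M, hM, hu, hus, hV, hL, hD⟩ := HardyCylinder.exists_almost_optimal
      (by omega : 0 < d) hcd (by linarith : 0 < (μ - c ^ 2) / 2) hr0 hr1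
    have hcs : HasCompactSupport u :=
      HasCompactSupport.of_support_subset_isCompact (isCompact_closedBall 0 r)
        ((subset_tsupport u).trans hus)
    have hut : HardyCylinder.IsTestFunction (HardyCylinder.cylinder d R) u :=
      ⟨hu, hcs, hus.trans (HardyCylinder.closedBall_subset_cylinder hrR)⟩
    obtain ⟨h1, -⟩ := hC u hu hcs
    obtain ⟨e1, e2, e3⟩ := hut.setIntegral_eq (HardyCylinder.potential d h)
    refine ⟨u, hut, h1.integrableOn, ?_⟩
    rw [e1, e2, e3]
    have hMV : M ≤ ∫ x, HardyCylinder.potential d h x * u x ^ 2 := by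
      rw [← hV]
      refine integral_mono_of_nonneg (Filter.Eventually.of_forall fun x => by positivity) h1
        (Filter.Eventually.of_forall fun x => ?_)
      exact mul_le_mul_of_nonneg_right (HardyCylinder.one_div_norm_sq_le_potential hh i x)
        (sq_nonneg _)
    have hlam : lam * ∫ x, u x ^ 2 ≤ (μ - c ^ 2) / 4 * M := by
      have hI : 0 ≤ ∫ x, u x ^ 2 := integral_nonneg fun x => sq_nonneg _
      calc lam * ∫ x, u x ^ 2 ≤ |lam| * (r ^ 2 * M) :=
            mul_le_mul (le_abs_self _) hL hI (abs_nonneg _)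
        _ = |lam| * r * r * M := by ring
        _ ≤ (|lam| + 1) * r * 1 * M := by gcongr; linarith
        _ ≤ (μ - c ^ 2) / 4 * M := by rw [mul_one]; gcongr
    have hμ0 : 0 ≤ μ := (sq_nonneg c).trans hμ.le
    have := mul_le_mul_of_nonneg_left hMV hμ0
    nlinarith [mul_pos (sub_pos.2 hμ) hM]
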